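/- Let $d\ge 1$, let $E$ be a finite-dimensional real inner product space with norm $|\cdot|$ (for instance $\mathbb R^n$, or matrices with the Euclidean norm), let $\alpha\in(0,1]$, and let $T_\alpha(Q)=|Q|^{\alpha-1}Q$ for $Q\in E$, with $T_\alpha(0)=0$. Notation. For an open ball $B=B_R(x_0)\subset\mathbb R^d$ with $R>0$, and $0<\rho\le\infty$, let $\|f\|_{L^\rho(B)}^{*}:=\big(-\!\!\!\!\!\int_B|f|^\rho\,dx\big)^{1/\rho}$ if $\rho<\infty$, and $\|f\|^{*}_{L^\infty(B)}:=\|f\|_{L^\infty(B)}$, where $-\!\!\!\!\!\int_S:=|S|^{-1}\int_S$. For $1\le w\le\infty$, $g\in L^w(B;E)$, $x\in B$ and $t>0$ let $$\operatorname{osc}^B_w g(x,t):=\Big(-\!\!\!\!\!\int_{B_t(x)\cap B}|g-\langle g\rangle_{B_t(x)\cap B}|^w\,dy\Big)^{1/w},\qquad \langle g\rangle_S:=-\!\!\!\!\!\int_S g\,dy$$ (essential supremum if $w=\infty$). For $s>0$ and $0<\rho,q\le\infty$ define the (possibly infinite) quantities $$|g|_{\mathbf B^{s}_{\rho,q}(B);w}:=R^s\Big(\int_0^R\Big(\frac{\|\operatorname{osc}^B_w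 g(\cdot,t)\|^{*}_{L^\rho(B)}}{t^s}\Big)^q\frac{dt}{t}\Big)^{1/q},\qquad |g|_{\mathbf F^{s}_{\rho,q}(B);w}:=R^s\Big\|\Big(\int_0^R\Big(\frac{\operatorname{osc}^B_w g(\cdot,t)}{t^s}\Big)^q\frac{dt}{t}\Big)^{1/q}\Big\|^{*}_{L^\rho(B)},$$ with the essential supremum over $0<t<R$ in place of the $t$-integral if $q=\infty$. Proposition. (a) Let $0<r\le\infty$. For every ball $B\subset\mathbb R^d$ and every measurable $G:B\to E$ we have, in $[0,\infty]$, $$\|T_\alpha(G)\|_{L^{r/\alpha}(B)}=\|G\|_{L^r(B)}^{\alpha}.$$ (b) Let $0<\rho,q\le\infty$ and $1\le w\le\infty$ satisfy $d\,(1/\rho-1/w)_+<s<1$, $s>0$, and let $1\le v\le w/\alpha$ (in particular, $v=w$ and $v=w/\alpha$ are allowed). Then there is a constant $C<\infty$, depending only on $d,E,\alpha,s,\rho,q,w,v$, such that for every ball $B\subset\mathbb R^d$ and every $G\in L^w(B;E)$ we have $T_\alpha(G)\in L^{v}(B;E)$ and $$|T_\alpha(G)|_{\mathbf B^{\alpha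 s}_{\rho/\alpha,q/\alpha}(B);v}\le C\,|G|_{\mathbf B^{s}_{\rho,q}(B);w}^{\alpha}.$$ If in addition $\rho<\infty$ and $d\,(1/q-1/w)_+<s$, then there is likewise a constant $C<\infty$, depending only on these parameters, such that for every ball $B$ and every $G\in L^w(B;E)$ $$|T_\alpha(G)|_{\mathbf F^{\alpha s}_{\rho/\alpha,q/\alpha}(B);v}\le C\,|G|_{\mathbf F^{s}_{\rho,q}(B);w}^{\alpha}.$$ -/

import Mathlib

open MeasureTheory
open scoped ENNReal NNReal

noncomputable section

namespace OscSpaces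

/-- The power map `T_α(Q) = |Q|^{α-1} Q`, with `T_α(0) = 0`. -/
def powerMap {E : Type*} [NormedAddCommGroup E] [NormedSpace ℝ E] (α : ℝ) (Q : E) : E :=
  ‖Q‖ ^ (α - 1) • Q

/-- Normalized Lebesgue measure on a set `S`, i.e. `|S|⁻¹ dx` restricted to `S`.  The `L^ρ` (quasi-)norm
with respect to it is the scaling invariant one: `(⨍_S |f|^ρ dx)^{1/ρ}` for `ρ < ∞`, and the essential
supremum over `S` for `ρ = ∞`. -/
def avgMeasure {d : ℕ} (S : Set (EuclideanSpace ℝ (Fin d))) :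
    Measure (EuclideanSpace ℝ (Fin d)) :=
  (volume S)⁻¹ • volume.restrict S

/-- The measure `dt / t` on the interval `(0, R)`. -/
def logMeasure (R : ℝ) : Measure ℝ :=
  (volume.restrict (Set.Ioo 0 R)).withDensity (fun t => ENNReal.ofReal t⁻¹)

section Seminorms

variable {d : ℕ} {E : Type*} [NormedAddCommGroup E] [NormedSpace ℝ E]

/-- The localized oscillation
`osc_w^B g (x, t) = (⨍_{B_t(x) ∩ B} |g - ⟨g⟩_{B_t(x) ∩ B}|^w dy)^{1/w}`
(essential supremum for `w = ∞`). -/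
def osc (w : ℝ≥0∞) (B : Set (EuclideanSpace ℝ (Fin d))) (g : EuclideanSpace ℝ (Fin d) → E)
    (x : EuclideanSpace ℝ (Fin d)) (t : ℝ) : ℝ≥0∞ :=
  eLpNorm (fun y => g y - ⨍ z in Metric.ball x t ∩ B, g z) w (avgMeasure (Metric.ball x t ∩ B))

/-- The Besov (quasi-)seminorm of `g` on `B = B_R(x₀)`, in terms of `w`-oscillations:
`R^s (∫_0^R (‖osc_w^B g(·, t)‖_{L^ρ(B)} / t^s)^q dt/t)^{1/q}`, with the scaling invariant norm of
`L^ρ(B)`, and the essential supremum over `0 < t < R` for `q = ∞`. -/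
def besovSeminorm (w : ℝ≥0∞) (s : ℝ) (ρ q : ℝ≥0∞) (x₀ : EuclideanSpace ℝ (Fin d)) (R : ℝ)
    (g : EuclideanSpace ℝ (Fin d) → E) : ℝ≥0∞ :=
  ENNReal.ofReal (R ^ s) *
    eLpNorm (fun t : ℝ =>
        eLpNorm (fun x => osc w (Metric.ball x₀ R) g x t) ρ (avgMeasure (Metric.ball x₀ R)) /
          ENNReal.ofReal (t ^ s))
      q (logMeasure R)

/-- The Triebel-Lizorkin (quasi-)seminorm of `g` on `B = B_R(x₀)`, in terms of `w`-oscillations: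
`R^s ‖(∫_0^R (osc_w^B g(·, t) / t^s)^q dt/t)^{1/q}‖_{L^ρ(B)}`, with the scaling invariant norm of
`L^ρ(B)`, and the essential supremum over `0 < t < R` for `q = ∞`. -/
def triebelLizorkinSeminorm (w : ℝ≥0∞) (s : ℝ) (ρ q : ℝ≥0∞) (x₀ : EuclideanSpace ℝ (Fin d))
    (R : ℝ) (g : EuclideanSpace ℝ (Fin d) → E) : ℝ≥0∞ :=
  ENNReal.ofReal (R ^ s) *
    eLpNorm (fun x =>
        eLpNorm (fun t : ℝ => osc w (Metric.ball x₀ R) g x t / ENNReal.ofReal (t ^ s))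
          q (logMeasure R))
      ρ (avgMeasure (Metric.ball x₀ R))

end Seminorms

/-- `0 < ρ, q ≤ ∞`, `1 ≤ w ≤ ∞` and `d (1/ρ - 1/w)_+ < s < 1`, where `1/∞ = 0`. -/
structure BesovAdmissible (d : ℕ) (s : ℝ) (ρ q w : ℝ≥0∞) : Prop where
  rho_pos : 0 < ρ
  q_pos : 0 < q
  one_le_w : 1 ≤ w
  s_pos : 0 < s
  lower : (d : ℝ) * max (ρ⁻¹.toReal - w⁻¹.toReal) 0 < s
  s_lt_one : s < 1

/-- In addition `ρ < ∞` and `d (1/q - 1/w)_+ < s`. -/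
structure TriebelLizorkinAdmissible (d : ℕ) (s : ℝ) (ρ q w : ℝ≥0∞) : Prop
    extends BesovAdmissible d s ρ q w where
  rho_lt_top : ρ < ∞
  lower_q : (d : ℝ) * max (q⁻¹.toReal - w⁻¹.toReal) 0 < s

end OscSpaces

end

/-!
The seminorm estimates come from a pointwise bound on oscillations.  On a probability space,
subtracting the mean is optimal up to the factor `2` among all constants, in every `L^p` with `p ≥ 1`
(`OscSpaces.eLpNorm_sub_integral_le`).  Since `T_α` is `α`-Hölder (`OscSpaces.norm_powerMap_sub_le`),
comparing `T_α(G)` with the constant `T_α(⟨G⟩)` and using Jensen to pass from `L^v` to `L^{w/α}`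
gives `osc_v T_α(G) (x, t) ≤ 8 (osc_w G (x, t))^α` (`OscSpaces.osc_powerMap_le`).

Everything else is the identity `‖|f|^α‖_{L^{p/α}} = ‖f‖_{L^p}^α`
(`OscSpaces.eLpNorm_enorm_rpow_div`) and monotonicity: since `|T_α(G)| = |G|^α`, it is the statement
on Lebesgue norms, and applied to the inner and then to the outer norm of the Besov and
Triebel-Lizorkin quantities, it gives both seminorm estimates with the constant `8`.
-/

open MeasureTheory
open scoped ENNReal NNReal

namespace OscSpaces

/-! ### The power map -/

section PowerMap

variable {E : Type*} [NormedAddCommGroup E] [NormedSpace ℝ E] {α : ℝ}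

theorem norm_powerMap (hα0 : 0 < α) (Q : E) : ‖powerMap α Q‖ = ‖Q‖ ^ α := by
  rw [powerMap, norm_smul, Real.norm_of_nonneg (by positivity)]
  simpa using (Real.rpow_add_one' (norm_nonneg Q) (y := α - 1) (by simpa using hα0.ne')).symm

theorem enorm_powerMap (hα0 : 0 < α) (Q : E) : ‖powerMap α Q‖ₑ = ‖Q‖ₑ ^ α := by
  rw [← ofReal_norm, norm_powerMap hα0, ← ofReal_norm,
    ENNReal.ofReal_rpow_of_nonneg (norm_nonneg _) hα0.le]

/-- The power map is `α`-Hölder continuous. -/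
theorem norm_powerMap_sub_le (hα0 : 0 < α) (hα1 : α ≤ 1) (P Q : E) :
    ‖powerMap α P - powerMap α Q‖ ≤ 4 * ‖P - Q‖ ^ α := by
  wlog hPQ : ‖Q‖ ≤ ‖P‖ generalizing P Q
  · rw [norm_sub_rev, norm_sub_rev P]
    exact this Q P (le_of_not_ge hPQ)
  rcases eq_or_ne P Q with rfl | hne
  · simp [Real.zero_rpow hα0.ne']
  have hD : 0 < ‖P - Q‖ := norm_pos_iff.2 (sub_ne_zero.2 hne)
  have hDle : ‖P - Q‖ ≤ 2 * ‖P‖ := (norm_sub_le P Q).trans (by linarith)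
  have hP : 0 < ‖P‖ := by linarith
  have hPα : ‖P‖ ^ (α - 1) * ‖P‖ = ‖P‖ ^ α := by
    simpa using (Real.rpow_add_one' hP.le (y := α - 1) (by simpa using hα0.ne')).symm
  have hQα : ‖Q‖ ^ (α - 1) * ‖Q‖ = ‖Q‖ ^ α := by
    simpa using
      (Real.rpow_add_one' (norm_nonneg Q) (y := α - 1) (by simpa using hα0.ne')).symm
  have hQP : ‖Q‖ ^ α ≤ ‖P‖ ^ α := Real.rpow_le_rpow (norm_nonneg Q) hPQ hα0.le
  have hanti : ‖P‖ ^ (α - 1) * ‖Q‖ ≤ ‖Q‖ ^ (α - 1) * ‖Q‖ := by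
    rcases (norm_nonneg Q).eq_or_lt with h0 | h0
    · simp [← h0]
    · exact mul_le_mul_of_nonneg_right
        (Real.rpow_le_rpow_of_nonpos h0 hPQ (by linarith)) h0.le
  have hPQ' : ‖P‖ - ‖Q‖ ≤ ‖P - Q‖ := norm_sub_norm_le P Q
  have hPpos : 0 < ‖P‖ ^ (α - 1) := Real.rpow_pos_of_pos hP _
  have hsplit : powerMap α P - powerMap α Q =
      ‖P‖ ^ (α - 1) • (P - Q) + (‖P‖ ^ (α - 1) - ‖Q‖ ^ (α - 1)) • Q := by
    simp only [powerMap, smul_sub, sub_smul]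
    abel
  have h1 : ‖‖P‖ ^ (α - 1) • (P - Q)‖ = ‖P‖ ^ (α - 1) * ‖P - Q‖ := by
    rw [norm_smul, Real.norm_of_nonneg hPpos.le]
  have h2 : ‖(‖P‖ ^ (α - 1) - ‖Q‖ ^ (α - 1)) • Q‖ ≤ ‖P‖ ^ (α - 1) * ‖P - Q‖ := by
    rw [norm_smul, Real.norm_eq_abs, ← abs_of_nonneg (norm_nonneg Q), ← abs_mul, abs_norm,
      abs_of_nonpos (by linarith)]
    nlinarith
  have h3 : ‖P‖ ^ (α - 1) * ‖P - Q‖ ≤ 2 * ‖P - Q‖ ^ α := by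
    -- `‖P‖ ≥ ‖P - Q‖ / 2` and the exponent `α - 1` is nonpositive.
    have hle : ‖P‖ ^ (α - 1) ≤ (‖P - Q‖ / 2) ^ (α - 1) :=
      Real.rpow_le_rpow_of_nonpos (by positivity) (by linarith) (by linarith)
    have heq : (‖P - Q‖ / 2) ^ (α - 1) * (‖P - Q‖ / 2) = (‖P - Q‖ / 2) ^ α := by
      simpa using (Real.rpow_add_one' (x := ‖P - Q‖ / 2) (by positivity) (y := α - 1)
        (by simpa using hα0.ne')).symm
    have hhalf : (‖P - Q‖ / 2) ^ α ≤ ‖P - Q‖ ^ α :=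
      Real.rpow_le_rpow (by positivity) (by linarith) hα0.le
    nlinarith
  rw [hsplit]
  linarith [norm_add_le (‖P‖ ^ (α - 1) • (P - Q)) ((‖P‖ ^ (α - 1) - ‖Q‖ ^ (α - 1)) • Q)]

theorem enorm_powerMap_sub_le (hα0 : 0 < α) (hα1 : α ≤ 1) (P Q : E) :
    ‖powerMap α P - powerMap α Q‖ₑ ≤ (4 : ℝ≥0) * ‖P - Q‖ₑ ^ α := by
  rw [← ofReal_norm, ← ofReal_norm, ENNReal.ofReal_rpow_of_nonneg (norm_nonneg _) hα0.le,
    ← ENNReal.ofReal_coe_nnreal, ← ENNReal.ofReal_mul (by positivity)]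
  exact ENNReal.ofReal_le_ofReal (norm_powerMap_sub_le hα0 hα1 P Q)

theorem continuous_powerMap (hα0 : 0 < α) (hα1 : α ≤ 1) :
    Continuous (powerMap α : E → E) := by
  have h : HolderWith 4 ⟨α, hα0.le⟩ (powerMap α : E → E) := fun P Q => by
    simp only [edist_eq_enorm_sub]
    exact enorm_powerMap_sub_le hα0 hα1 P Q
  exact h.continuous hα0

end PowerMap

/-! ### Powers and means in Lebesgue spaces -/

section Lebesgue

variable {X E : Type*} {mX : MeasurableSpace X} {μ : Measure X}
  [NormedAddCommGroup E] [NormedSpace ℝ E] {α : ℝ}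

theorem eLpNorm_enorm_rpow_div {ε : Type*} [TopologicalSpace ε] [ContinuousENorm ε]
    (hα0 : 0 < α) (f : X → ε) (p : ℝ≥0∞) :
    eLpNorm (fun x => ‖f x‖ₑ ^ α) (p / ENNReal.ofReal α) μ = eLpNorm f p μ ^ α := by
  rw [eLpNorm_enorm_rpow f hα0,
    ENNReal.div_mul_cancel (ENNReal.ofReal_pos.2 hα0).ne' ENNReal.ofReal_ne_top]

/-- A pointwise bound by the `α`-th power turns into a bound of the `L^{p/α}` norm by the `α`-th power
of the `L^p` norm.  No measurability is required, because the constant is finite. -/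
theorem eLpNorm_div_le_of_le_rpow {ε ε' : Type*} [TopologicalSpace ε] [ContinuousENorm ε]
    [TopologicalSpace ε'] [ContinuousENorm ε'] (hα0 : 0 < α) {c : ℝ≥0} {f : X → ε} {g : X → ε'}
    (h : ∀ x, ‖f x‖ₑ ≤ c * ‖g x‖ₑ ^ α) (p : ℝ≥0∞) :
    eLpNorm f (p / ENNReal.ofReal α) μ ≤ c * eLpNorm g p μ ^ α := by
  rw [← eLpNorm_enorm_rpow_div hα0 g p]
  exact eLpNorm_le_nnreal_smul_eLpNorm_of_ae_le_mul'
    (Filter.Eventually.of_forall fun x => by simpa only [enorm_eq_self] using h x) _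

theorem eLpNorm_powerMap (hα0 : 0 < α) (G : X → E) (p : ℝ≥0∞) :
    eLpNorm (fun x => powerMap α (G x)) (p / ENNReal.ofReal α) μ = eLpNorm G p μ ^ α := by
  rw [← eLpNorm_enorm_rpow_div hα0 G p]
  exact eLpNorm_congr_enorm_ae
    (Filter.Eventually.of_forall fun x => by simp only [enorm_powerMap hα0, enorm_eq_self])

theorem memLp_powerMap [IsFiniteMeasure μ] (hα0 : 0 < α) (hα1 : α ≤ 1) {G : X → E} {w v : ℝ≥0∞}
    (hv : v ≤ w / ENNReal.ofReal α) (hG : MemLp G w μ) :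
    MemLp (fun x => powerMap α (G x)) v μ := by
  refine MemLp.mono_exponent (q := w / ENNReal.ofReal α)
    ⟨(continuous_powerMap hα0 hα1).comp_aestronglyMeasurable hG.1, ?_⟩ hv
  rw [eLpNorm_powerMap hα0]
  exact ENNReal.rpow_lt_top_of_nonneg hα0.le hG.2.ne

/-- The mean is, up to a factor `2`, the constant closest to a function in `L^p`. -/
theorem eLpNorm_sub_integral_le [CompleteSpace E] [IsProbabilityMeasure μ] {f : X → E}
    (hf : Integrable f μ) {p : ℝ≥0∞} (hp : 1 ≤ p) (c : E) :
    eLpNorm (fun y => f y - ∫ z, f z ∂μ) p μ ≤ 2 * eLpNorm (fun y => f y - c) p μ := by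
  have hfc : Integrable (fun y => f y - c) μ := hf.sub (integrable_const c)
  have hmean : ‖∫ z, (f z - c) ∂μ‖ₑ ≤ eLpNorm (fun y => f y - c) p μ :=
    calc ‖∫ z, (f z - c) ∂μ‖ₑ ≤ ∫⁻ z, ‖f z - c‖ₑ ∂μ := enorm_integral_le_lintegral_enorm _
      _ = eLpNorm (fun y => f y - c) 1 μ := eLpNorm_one_eq_lintegral_enorm.symm
      _ ≤ eLpNorm (fun y => f y - c) p μ := eLpNorm_le_eLpNorm_of_exponent_le hp hfc.1
  have hsplit : (fun y => f y - ∫ z, f z ∂μ) =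
      (fun y => f y - c) - fun _ => ∫ z, (f z - c) ∂μ := by
    funext y
    simp [integral_sub hf (integrable_const c)]
  rw [hsplit, two_mul]
  refine (eLpNorm_sub_le hfc.1 aestronglyMeasurable_const hp).trans (add_le_add le_rfl ?_)
  rw [eLpNorm_const _ (by positivity) (NeZero.ne μ)]
  simpa using hmean

/-- Oscillation of `T_α(G)` around its mean, on a probability space. -/
theorem eLpNorm_powerMap_sub_integral_le [CompleteSpace E] [IsProbabilityMeasure μ]
    (hα0 : 0 < α) (hα1 : α ≤ 1) {G : X → E} {w v : ℝ≥0∞} (hv1 : 1 ≤ v)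
    (hv : v ≤ w / ENNReal.ofReal α) (hG : MemLp G w μ) (c : E) :
    eLpNorm (fun y => powerMap α (G y) - ∫ z, powerMap α (G z) ∂μ) v μ ≤
      (8 : ℝ≥0) * eLpNorm (fun y => G y - c) w μ ^ α := by
  have hT : MemLp (fun y => powerMap α (G y)) v μ := memLp_powerMap hα0 hα1 hv hG
  calc eLpNorm (fun y => powerMap α (G y) - ∫ z, powerMap α (G z) ∂μ) v μ
      ≤ 2 * eLpNorm (fun y => powerMap α (G y) - powerMap α c) v μ :=
        eLpNorm_sub_integral_le (hT.integrable hv1) hv1 _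
    _ ≤ 2 * eLpNorm (fun y => powerMap α (G y) - powerMap α c) (w / ENNReal.ofReal α) μ := by
        gcongr
        exact eLpNorm_le_eLpNorm_of_exponent_le hv (hT.1.sub aestronglyMeasurable_const)
    _ ≤ 2 * ((4 : ℝ≥0) * eLpNorm (fun y => G y - c) w μ ^ α) := by
        gcongr
        exact eLpNorm_div_le_of_le_rpow hα0
          (fun y => enorm_powerMap_sub_le hα0 hα1 (G y) c) w
    _ = (8 : ℝ≥0) * eLpNorm (fun y => G y - c) w μ ^ α := by
        rw [← mul_assoc]
        norm_num

end Lebesgue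

/-! ### Oscillations and seminorms -/

section Seminorms

variable {d : ℕ} {E : Type*} [NormedAddCommGroup E] [NormedSpace ℝ E] {α : ℝ}

theorem osc_powerMap_le [CompleteSpace E] (hα0 : 0 < α) (hα1 : α ≤ 1) {w v : ℝ≥0∞} (hv1 : 1 ≤ v)
    (hv : v ≤ w / ENNReal.ofReal α) {x₀ : EuclideanSpace ℝ (Fin d)} {R : ℝ}
    {G : EuclideanSpace ℝ (Fin d) → E}
    (hG : MemLp G w (volume.restrict (Metric.ball x₀ R))) (x : EuclideanSpace ℝ (Fin d)) (t : ℝ) :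
    osc v (Metric.ball x₀ R) (fun y => powerMap α (G y)) x t ≤
      (8 : ℝ≥0) * osc w (Metric.ball x₀ R) G x t ^ α := by
  rcases eq_or_ne (volume (Metric.ball x t ∩ Metric.ball x₀ R)) 0 with h0 | h0
  · -- On a null set the averaging measure is `∞ • 0 = 0`.
    have hzero : avgMeasure (Metric.ball x t ∩ Metric.ball x₀ R) = 0 := by
      rw [avgMeasure, Measure.restrict_eq_zero.2 h0, smul_zero]
    simp [osc, hzero]
  · have hfin : volume (Metric.ball x t ∩ Metric.ball x₀ R) ≠ ∞ :=
      ((measure_mono Set.inter_subset_right).trans_lt measure_ball_lt_top).ne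
    have : IsProbabilityMeasure (avgMeasure (Metric.ball x t ∩ Metric.ball x₀ R)) :=
      ⟨by simp [avgMeasure, ENNReal.inv_mul_cancel h0 hfin]⟩
    have hG' : MemLp G w (avgMeasure (Metric.ball x t ∩ Metric.ball x₀ R)) :=
      (hG.mono_measure (Measure.restrict_mono Set.inter_subset_right le_rfl)).smul_measure
        (ENNReal.inv_ne_top.2 h0)
    simp only [osc, setAverage_eq']
    exact eLpNorm_powerMap_sub_integral_le hα0 hα1 hv1 hv hG' _

theorem ofReal_rpow_mul (hα0 : 0 < α) {t : ℝ} (ht : 0 ≤ t) (s : ℝ) :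
    ENNReal.ofReal (t ^ (α * s)) = ENNReal.ofReal (t ^ s) ^ α := by
  rw [ENNReal.ofReal_rpow_of_nonneg (by positivity) hα0.le, ← Real.rpow_mul ht, mul_comm]

theorem ae_logMeasure_pos (R : ℝ) : ∀ᵐ t ∂logMeasure R, 0 < t :=
  (withDensity_absolutelyContinuous _ _).ae_le
    ((ae_restrict_mem measurableSet_Ioo).mono fun _ ht => ht.1)

/-- Raising a weighted norm in `dt / t` to the power `α` divides its exponent by `α` and multiplies its
order of smoothness by `α`. -/
theorem eLpNorm_logMeasure_div_le (hα0 : 0 < α) {c : ℝ≥0} {f g : ℝ → ℝ≥0∞}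
    (h : ∀ t, f t ≤ c * g t ^ α) (s R : ℝ) (q : ℝ≥0∞) :
    eLpNorm (fun t => f t / ENNReal.ofReal (t ^ (α * s))) (q / ENNReal.ofReal α) (logMeasure R) ≤
      c * eLpNorm (fun t => g t / ENNReal.ofReal (t ^ s)) q (logMeasure R) ^ α := by
  rw [← eLpNorm_enorm_rpow_div hα0 _ q]
  refine eLpNorm_le_nnreal_smul_eLpNorm_of_ae_le_mul' ?_ _
  filter_upwards [ae_logMeasure_pos R] with t ht
  simp only [enorm_eq_self]
  rw [ofReal_rpow_mul hα0 ht.le, ENNReal.div_rpow_of_nonneg _ _ hα0.le, ← mul_div_assoc]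
  exact ENNReal.div_le_div_right (h t) _

theorem ofReal_mul_le_of_le_rpow (hα0 : 0 < α) {c : ℝ≥0} {a b : ℝ≥0∞} (h : a ≤ c * b ^ α)
    {R : ℝ} (hR : 0 ≤ R) (s : ℝ) :
    ENNReal.ofReal (R ^ (α * s)) * a ≤ c * (ENNReal.ofReal (R ^ s) * b) ^ α := by
  rw [ofReal_rpow_mul hα0 hR, ENNReal.mul_rpow_of_nonneg _ _ hα0.le, mul_left_comm]
  gcongr

theorem besovSeminorm_powerMap_le [CompleteSpace E] (hα0 : 0 < α) (hα1 : α ≤ 1) {w v : ℝ≥0∞}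
    (hv1 : 1 ≤ v) (hv : v ≤ w / ENNReal.ofReal α) (s : ℝ) (ρ q : ℝ≥0∞)
    {x₀ : EuclideanSpace ℝ (Fin d)} {R : ℝ} (hR : 0 < R) {G : EuclideanSpace ℝ (Fin d) → E}
    (hG : MemLp G w (volume.restrict (Metric.ball x₀ R))) :
    besovSeminorm v (α * s) (ρ / ENNReal.ofReal α) (q / ENNReal.ofReal α) x₀ R
        (fun x => powerMap α (G x)) ≤
      (8 : ℝ≥0) * besovSeminorm w s ρ q x₀ R G ^ α := by
  refine ofReal_mul_le_of_le_rpow hα0 (eLpNorm_logMeasure_div_le hα0 (fun t => ?_) s R q) hR.le s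
  exact eLpNorm_div_le_of_le_rpow hα0 (fun x => osc_powerMap_le hα0 hα1 hv1 hv hG x t) ρ

theorem triebelLizorkinSeminorm_powerMap_le [CompleteSpace E] (hα0 : 0 < α) (hα1 : α ≤ 1)
    {w v : ℝ≥0∞} (hv1 : 1 ≤ v) (hv : v ≤ w / ENNReal.ofReal α) (s : ℝ) (ρ q : ℝ≥0∞)
    {x₀ : EuclideanSpace ℝ (Fin d)} {R : ℝ} (hR : 0 < R) {G : EuclideanSpace ℝ (Fin d) → E}
    (hG : MemLp G w (volume.restrict (Metric.ball x₀ R))) :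
    triebelLizorkinSeminorm v (α * s) (ρ / ENNReal.ofReal α) (q / ENNReal.ofReal α) x₀ R
        (fun x => powerMap α (G x)) ≤
      (8 : ℝ≥0) * triebelLizorkinSeminorm w s ρ q x₀ R G ^ α := by
  refine ofReal_mul_le_of_le_rpow hα0 (eLpNorm_div_le_of_le_rpow hα0 (fun x => ?_) ρ) hR.le s
  exact eLpNorm_logMeasure_div_le hα0 (fun t => osc_powerMap_le hα0 hα1 hv1 hv hG x t) s R q

end Seminorms

end OscSpaces

theorem proposition4p4 (d : ℕ) {E : Type*} [NormedAddCommGroup E] [InnerProductSpace ℝ E]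
    [FiniteDimensional ℝ E] (α : ℝ) (hα0 : 0 < α) (hα1 : α ≤ 1) :
    (∀ (r : ℝ≥0∞), 0 < r →
      ∀ (x₀ : EuclideanSpace ℝ (Fin d)) (R : ℝ), 0 < R →
      ∀ G : EuclideanSpace ℝ (Fin d) → E,
        AEStronglyMeasurable G (volume.restrict (Metric.ball x₀ R)) →
        eLpNorm (fun x => OscSpaces.powerMap α (G x)) (r / ENNReal.ofReal α)
            (volume.restrict (Metric.ball x₀ R)) =
          eLpNorm G r (volume.restrict (Metric.ball x₀ R)) ^ α) ∧
    (∀ (s : ℝ) (ρ q w v : ℝ≥0∞), OscSpaces.BesovAdmissible d s ρ q w →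
      1 ≤ v → v ≤ w / ENNReal.ofReal α →
      ∃ C : ℝ≥0, ∀ (x₀ : EuclideanSpace ℝ (Fin d)) (R : ℝ), 0 < R →
      ∀ G : EuclideanSpace ℝ (Fin d) → E,
        MemLp G w (volume.restrict (Metric.ball x₀ R)) →
        MemLp (fun x => OscSpaces.powerMap α (G x)) v (volume.restrict (Metric.ball x₀ R)) ∧
        OscSpaces.besovSeminorm v (α * s) (ρ / ENNReal.ofReal α) (q / ENNReal.ofReal α) x₀ R
            (fun x => OscSpaces.powerMap α (G x)) ≤
          C * OscSpaces.besovSeminorm w s ρ q x₀ R G ^ α) ∧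
    (∀ (s : ℝ) (ρ q w v : ℝ≥0∞), OscSpaces.TriebelLizorkinAdmissible d s ρ q w →
      1 ≤ v → v ≤ w / ENNReal.ofReal α →
      ∃ C : ℝ≥0, ∀ (x₀ : EuclideanSpace ℝ (Fin d)) (R : ℝ), 0 < R →
      ∀ G : EuclideanSpace ℝ (Fin d) → E,
        MemLp G w (volume.restrict (Metric.ball x₀ R)) →
        MemLp (fun x => OscSpaces.powerMap α (G x)) v (volume.restrict (Metric.ball x₀ R)) ∧
        OscSpaces.triebelLizorkinSeminorm v (α * s) (ρ / ENNReal.ofReal α)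
            (q / ENNReal.ofReal α) x₀ R (fun x => OscSpaces.powerMap α (G x)) ≤
          C * OscSpaces.triebelLizorkinSeminorm w s ρ q x₀ R G ^ α) := by
  have hfin (x₀ : EuclideanSpace ℝ (Fin d)) (R : ℝ) :
      IsFiniteMeasure (volume.restrict (Metric.ball x₀ R)) :=
    isFiniteMeasure_restrict.2 measure_ball_lt_top.ne
  refine ⟨fun r _ x₀ R _ G _ => OscSpaces.eLpNorm_powerMap hα0 G r, ?_, ?_⟩
  · intro s ρ q w v _ hv1 hv
    exact ⟨8, fun x₀ R hR G hG => ⟨OscSpaces.memLp_powerMap hα0 hα1 hv hG,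
      OscSpaces.besovSeminorm_powerMap_le hα0 hα1 hv1 hv s ρ q hR hG⟩⟩
  · intro s ρ q w v _ hv1 hv
    exact ⟨8, fun x₀ R hR G hG => ⟨OscSpaces.memLp_powerMap hα0 hα1 hv hG,
      OscSpaces.triebelLizorkinSeminorm_powerMap_le hα0 hα1 hv1 hv s ρ q hR hG⟩⟩
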